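/- Let $\mathcal H$ be an infinite-dimensional separable complex Hilbert space, let $\mathcal B(\mathcal H)$ be the algebra of bounded linear operators on $\mathcal H$, and let $\mathcal H\otimes\mathcal H$ be the Hilbert space tensor product. Equip $\mathcal B(\mathcal H)$ and $\mathcal B(\mathcal H\otimes\mathcal H)$ with their $W^*$-topologies (the weak* topologies as duals of the trace class operators: the coarsest topologies making $A\mapsto \mathrm{tr}(AT)$ continuous for every trace class operator $T$), and let $\Psi:\mathcal B(\mathcal H)\to\mathcal B(\mathcal H\otimes\mathcal H)$ be a linear map that is continuous for these topologies. For a unit vector $e\in\mathcal H$ let $ee^*$ denote the rank-one projection $z\mapsto\langle z,e\rangle e$, and let $S\in\mathcal B(\mathcal H\otimes\mathcal H)$ be the swap operator, $S(x\otimes y)=y\otimes x$. Then the following statements are equivalent: (a) $\Psi$ is covariant under unitary evolution, that is, $\Psi(UXU^*)=(U\otimes U)\Psi(X)(U^*\otimes U^*)$ for all $X\in\mathcal B(\mathcal H)$ and all unitary operators $U$ on $\mathcal H$; (b) $\Psi(Uee^*U^*)=(U\otimes U)\Psi(ee^*)(U^*\otimes U^*)$ for all unit vectors $e\in\mathcal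 H$ and all unitary operators $U$ on $\mathcal H$; (c) there exist complex numbers $\lambda_1,\lambda_2,\lambda_3,\lambda_4$ such that $$\Psi(X)=\lambda_1\, I\otimes X+\lambda_2\, X\otimes I+\lambda_3\, S(I\otimes X)+\lambda_4\, S(X\otimes I)\qquad\text{for all }X\in\mathcal B(\mathcal H).$$ -/

import Mathlib

open scoped TensorProduct

namespace CovariantMaps

noncomputable section

/-- `B(H)`: the bounded linear operators on `H`. -/
abbrev BOp (H : Type*) [NormedAddCommGroup H] [InnerProductSpace ℂ H] : Type _ := H →L[ℂ] H

/-- The Hilbert space tensor product `H ⊗ H`: the completion of the algebraic tensor product for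
the inner product with `⟪x ⊗ y, x' ⊗ y'⟫ = ⟪x, x'⟫ * ⟪y, y'⟫`. -/
abbrev HTensor (H : Type*) [NormedAddCommGroup H] [InnerProductSpace ℂ H] : Type _ :=
  UniformSpace.Completion (H ⊗[ℂ] H)

section Tensor

variable {H : Type*} [NormedAddCommGroup H] [InnerProductSpace ℂ H]

/-- The elementary tensor `x ⊗ y` as a vector of the Hilbert space `H ⊗ H`. -/
def htmul (x y : H) : HTensor H := ((x ⊗ₜ[ℂ] y : H ⊗[ℂ] H) : HTensor H)

/-- The operator `A ⊗ B` on the Hilbert space `H ⊗ H`. -/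
def opTensor (A B : BOp H) : BOp (HTensor H) := (TensorProduct.mapL A B).completion

/-- The swap operator `S` on the Hilbert space `H ⊗ H`. -/
def swapOp (H : Type*) [NormedAddCommGroup H] [InnerProductSpace ℂ H] : BOp (HTensor H) :=
  ((TensorProduct.commIsometry ℂ H H).toContinuousLinearEquiv :
    (H ⊗[ℂ] H) →L[ℂ] (H ⊗[ℂ] H)).completion

theorem opTensor_htmul (A B : BOp H) (x y : H) :
    opTensor A B (htmul x y) = htmul (A x) (B y) := by
  simp [opTensor, htmul]

theorem swapOp_htmul (x y : H) : swapOp H (htmul x y) = htmul y x := by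
  simp [swapOp, htmul]

end Tensor

section TraceClass

variable (K : Type*) [NormedAddCommGroup K] [InnerProductSpace ℂ K] [CompleteSpace K]

/-- The index set of a fixed orthonormal basis of the Hilbert space `K`. -/
def basisIndex : Set K := (exists_hilbertBasis ℂ K).choose

/-- A fixed orthonormal basis of the Hilbert space `K`. Neither the trace class nor the trace
of a trace class operator depends on this choice. -/
def fixedBasis : HilbertBasis (basisIndex K) ℂ K := (exists_hilbertBasis ℂ K).choose_spec.choose

variable {K}

/-- `T` is of trace class: the sum `∑ i, ⟪e i, |T| (e i)⟫` of non-negative reals converges, where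
`|T| = (T* T) ^ (1 / 2)` and `e` is an orthonormal basis. -/
def IsTraceClass (T : BOp K) : Prop :=
  Summable fun i => (inner ℂ (fixedBasis K i) (CFC.abs T (fixedBasis K i))).re

/-- The trace `∑ i, ⟪e i, T (e i)⟫`, used for trace class operators only. -/
def trace (T : BOp K) : ℂ := ∑' i, inner ℂ (fixedBasis K i) (T (fixedBasis K i))

variable (K)

/-- The weak-star topology on `B(K)`, as the dual of the trace class `T(K)`: the coarsest topology
for which all functionals `A ↦ tr (A T)`, `T` of trace class, are continuous. -/
abbrev wStarTopology : TopologicalSpace (BOp K) :=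
  TopologicalSpace.induced
    (fun (A : BOp K) (T : {T : BOp K // IsTraceClass T}) => trace (A * (T : BOp K)))
    Pi.topologicalSpace

end TraceClass

/-- Covariance under unitary evolution:
`Ψ (U X U*) = (U ⊗ U) Ψ(X) (U* ⊗ U*)` for all `X` in `B(H)` and all unitary `U`. -/
def IsUnitarilyCovariant {H : Type*} [NormedAddCommGroup H] [InnerProductSpace ℂ H]
    [CompleteSpace H] (Ψ : BOp H →ₗ[ℂ] BOp (HTensor H)) : Prop :=
  ∀ X : BOp H, ∀ U ∈ unitary (BOp H),
    Ψ (U * X * star U) = opTensor U U * Ψ X * opTensor (star U) (star U)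

end

end CovariantMaps

open InnerProductSpace Filter Topology

namespace CovariantMaps

noncomputable section

/-! The substance is that covariance on rank-one projections forces the four-term form. By
polarization, covariance holds on all rank-one operators. Testing it on the unitaries `1 + (z - 1) e
e*` with `|z| = 1` and extracting the first-order part gives a Leibniz rule for commutators with
rank-one operators (`map_lie_of_covariant`). For the matrix coefficients of `Ψ` this is a
contraction identity (`coeff_derivation`). With auxiliary unit vectors, which infinite dimension
supplies, it moves each `xᵢ` into a pairing with some `yⱼ`, so the coefficients are combinations of
the six pairings of three vectors with three vectors (`exists_coeff_eq`). Two of these pairings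
would give `tr(X)` terms. Weak-star continuity makes `∑ Ψ(eᵢeᵢ* X)` converge weakly to `Ψ(X)`; at `X
= 1` the summands must tend to zero, which kills the trace terms. Summing the other four pairings
for general `X` yields the formula. -/

theorem hasSum_norm_inner_sq {K : Type*} [NormedAddCommGroup K] [InnerProductSpace ℂ K] {ι : Type*}
    (b : HilbertBasis ι ℂ K) (x : K) :
    HasSum (fun i => ‖inner ℂ (b i) x‖ ^ 2) (‖x‖ ^ 2) := by
  have h := (b.hasSum_inner_mul_inner x x).mapL Complex.reCLM
  have h1 : Complex.reCLM (inner ℂ x x) = ‖x‖ ^ 2 := by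
    rw [inner_self_eq_norm_sq_to_K, Complex.reCLM_apply]
    norm_cast
  rw [h1] at h
  refine h.congr_fun fun i => ?_
  rw [Complex.reCLM_apply, ← inner_conj_symm x (b i), RCLike.conj_mul]
  norm_cast

/-! ### Trace class operators and weak-star convergence of truncations -/

section TraceClass

variable {K : Type*} [NormedAddCommGroup K] [InnerProductSpace ℂ K] [CompleteSpace K]

theorem abs_rankOne (x y : K) :
    CFC.abs (rankOne ℂ x y : BOp K) = (‖x‖ / ‖y‖ : ℝ) • (rankOne ℂ y y : BOp K) := by
  have hpos : (0 : BOp K) ≤ (‖x‖ / ‖y‖ : ℝ) • (rankOne ℂ y y : BOp K) := by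
    refine smul_nonneg (by positivity) ?_
    exact (ContinuousLinearMap.nonneg_iff_isPositive _).2 (isPositive_rankOne_self y)
  refine CFC.sqrt_unique ?_ hpos
  rcases eq_or_ne y 0 with rfl | hy
  · simp
  have hy' : (‖y‖ : ℂ) ≠ 0 := by simpa using hy
  ext z
  simp only [ContinuousLinearMap.star_eq_adjoint, adjoint_rankOne, mul_apply_eq_comp,
    rankOne_apply, smul_apply, inner_smul_right, smul_smul,
    inner_self_eq_norm_sq_to_K, ← Complex.coe_smul]
  congr 1
  push_cast
  simp only [Complex.coe_algebraMap]
  field_simp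

theorem isTraceClass_rankOne (x y : K) : IsTraceClass (rankOne ℂ x y : BOp K) := by
  unfold IsTraceClass
  rw [abs_rankOne]
  have h := ((fixedBasis K).summable_inner_mul_inner y y).mapL Complex.reCLM
  refine (h.mul_left (‖x‖ / ‖y‖)).congr fun i => ?_
  simp only [smul_apply, rankOne_apply, ← Complex.coe_smul, inner_smul_right,
    Complex.re_ofReal_mul, Complex.reCLM_apply]

theorem trace_mul_rankOne (A : BOp K) (x y : K) :
    trace (A * rankOne ℂ x y) = inner ℂ y (A x) := by
  unfold trace
  rw [← (fixedBasis K).tsum_inner_mul_inner y (A x)]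
  refine tsum_congr fun i => ?_
  simp

theorem norm_abs_apply (T : BOp K) (x : K) : ‖CFC.abs T x‖ = ‖T x‖ := by
  have h : inner ℂ (CFC.abs T x) (CFC.abs T x) = inner ℂ (T x) (T x) := by
    have hs : IsSelfAdjoint (CFC.abs T) := (CFC.abs_nonneg T).isSelfAdjoint
    have h1 : inner ℂ (CFC.abs T x) (CFC.abs T x) = inner ℂ ((CFC.abs T * CFC.abs T) x) x := by
      conv_lhs => rw [← ContinuousLinearMap.adjoint_inner_left, ← ContinuousLinearMap.star_eq_adjoint,
        hs.star_eq]
      rfl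
    rw [h1, CFC.abs_mul_abs, mul_apply_eq_comp, ContinuousLinearMap.star_eq_adjoint,
      ContinuousLinearMap.adjoint_inner_left]
  rw [inner_self_eq_norm_sq_to_K, inner_self_eq_norm_sq_to_K] at h
  have h' : ‖CFC.abs T x‖ ^ 2 = ‖T x‖ ^ 2 := by exact_mod_cast h
  exact (sq_eq_sq₀ (norm_nonneg _) (norm_nonneg _)).1 h'

/-- Half of the polar decomposition: `T` factors through `|T|`. -/
theorem exists_eq_mul_abs (T : BOp K) : ∃ V : BOp K, T = V * CFC.abs T := by
  let R : Submodule ℂ K := (CFC.abs T).range.topologicalClosure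
  have hR : ∀ x, CFC.abs T x ∈ R := fun x =>
    Submodule.le_topologicalClosure _ (LinearMap.mem_range_self _ x)
  let e : K →ₗ[ℂ] R := (CFC.abs T).toLinearMap.codRestrict R hR
  have hd : DenseRange e := by
    intro y
    rw [closure_subtype]
    have hy := y.2
    rw [← SetLike.mem_coe, Submodule.topologicalClosure_coe] at hy
    convert hy using 1
    congr 1
    ext z
    constructor
    · rintro ⟨_, ⟨x, rfl⟩, rfl⟩
      exact ⟨x, rfl⟩
    · rintro ⟨x, rfl⟩
      exact ⟨_, ⟨x, rfl⟩, rfl⟩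
  have : CompleteSpace R := (Submodule.isClosed_topologicalClosure _).completeSpace_coe
  -- `V` sends `|T| x` to `T x`, isometrically by `norm_abs_apply`; it extends to the closure of the
  -- range and vanishes on the complement.
  refine ⟨(T.toLinearMap.extendOfNorm e).comp R.orthogonalProjectionOnto, ?_⟩
  ext x
  have h1 : R.orthogonalProjectionOnto (CFC.abs T x) = e x :=
    Submodule.orthogonalProjectionOnto_mem_subspace_eq_self (e x)
  have h2 := LinearMap.extendOfNorm_eq (f := T.toLinearMap) hd
    ⟨1, fun x => by rw [one_mul]; exact (norm_abs_apply T x).ge⟩ x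
  rw [mul_apply_eq_comp, ContinuousLinearMap.comp_apply, h1, h2]
  rfl

/-- Right ideal property of the Hilbert–Schmidt operators, for a self-adjoint operator. -/
theorem summable_norm_sq_mul {ι : Type*} (b : HilbertBasis ι ℂ K) {A : BOp K}
    (hA : IsSelfAdjoint A) (h : Summable fun i => ‖A (b i)‖ ^ 2) (Y : BOp K) :
    Summable fun i => ‖A (Y (b i))‖ ^ 2 := by
  have hrow (j : ι) := hasSum_norm_inner_sq b (star Y (A (b j)))
  have hnn : 0 ≤ fun p : ι × ι => ‖inner ℂ (b p.2) (star Y (A (b p.1)))‖ ^ 2 :=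
    fun p => sq_nonneg _
  have hpair : Summable fun p : ι × ι => ‖inner ℂ (b p.2) (star Y (A (b p.1)))‖ ^ 2 := by
    refine (summable_prod_of_nonneg hnn).2 ⟨fun j => (hrow j).summable, ?_⟩
    refine Summable.congr (f := fun j => ‖star Y (A (b j))‖ ^ 2) ?_ fun j => (hrow j).tsum_eq.symm
    refine Summable.of_nonneg_of_le (fun j => by positivity) (fun j => ?_)
      (h.mul_left (‖star Y‖ ^ 2))
    rw [← mul_pow]
    exact pow_le_pow_left₀ (norm_nonneg _) ((star Y).le_opNorm _) 2
  -- Tonelli: the squared matrix entries of `A Y` are summed by columns instead of rows.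
  have hs := ((summable_prod_of_nonneg fun p => hnn p.swap).1 hpair.prod_symm).2
  refine hs.congr fun i => ?_
  rw [← (hasSum_norm_inner_sq b (A (Y (b i)))).tsum_eq]
  refine tsum_congr fun j => ?_
  change ‖inner ℂ (b i) (star Y (A (b j)))‖ ^ 2 = _
  rw [ContinuousLinearMap.star_eq_adjoint, ContinuousLinearMap.adjoint_inner_right, norm_inner_symm]
  conv_rhs => rw [← ContinuousLinearMap.adjoint_inner_left, ← ContinuousLinearMap.star_eq_adjoint,
    hA.star_eq]

/-- With `A = |T|^(1/2)`, which is Hilbert–Schmidt, `X T = (X V) A A`. Each diagonal entry is thus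
an inner product of two square-summable families. -/
theorem IsTraceClass.summable_inner_mul {T : BOp K} (hT : IsTraceClass T) (X : BOp K) :
    Summable fun i => inner ℂ (fixedBasis K i) (X (T (fixedBasis K i))) := by
  obtain ⟨V, hV⟩ := exists_eq_mul_abs T
  set A : BOp K := CFC.sqrt (CFC.abs T) with hA
  have hAs : IsSelfAdjoint A := (CFC.sqrt_nonneg _).isSelfAdjoint
  have hAA : A * A = CFC.abs T := CFC.sqrt_mul_sqrt_self _ (CFC.abs_nonneg T)
  have hadj (x y : K) : inner ℂ x (A y) = inner ℂ (A x) y := by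
    rw [← ContinuousLinearMap.adjoint_inner_left, ← ContinuousLinearMap.star_eq_adjoint, hAs.star_eq]
  have hHS : Summable fun i => ‖A (fixedBasis K i)‖ ^ 2 := by
    refine hT.congr fun i => ?_
    rw [← hAA, mul_apply_eq_comp, hadj, inner_self_eq_norm_sq_to_K]
    norm_cast
  have hHS' := summable_norm_sq_mul (fixedBasis K) hAs hHS (star (X * V))
  refine Summable.of_norm_bounded (hHS.add hHS') fun i => ?_
  have h1 : inner ℂ (fixedBasis K i) (X (T (fixedBasis K i))) =
      inner ℂ (A (star (X * V) (fixedBasis K i))) (A (fixedBasis K i)) := by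
    rw [← hadj, ContinuousLinearMap.star_eq_adjoint, ContinuousLinearMap.adjoint_inner_left]
    conv_lhs => rw [hV, ← hAA]
    rfl
  rw [h1]
  refine (norm_inner_le_norm _ _).trans ?_
  nlinarith [sq_nonneg (‖A (star (X * V) (fixedBasis K i))‖ - ‖A (fixedBasis K i)‖),
    sq_nonneg ‖A (star (X * V) (fixedBasis K i))‖, sq_nonneg ‖A (fixedBasis K i)‖]

theorem hasSum_trace_mul {T : BOp K} (hT : IsTraceClass T) (X : BOp K) :
    HasSum (fun i => trace ((rankOne ℂ (fixedBasis K i) (fixedBasis K i) * X) * T))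
      (trace (X * T)) := by
  refine (hT.summable_inner_mul X).hasSum.congr_fun fun i => ?_
  unfold trace
  rw [tsum_eq_single i]
  · simp [(fixedBasis K).orthonormal.1 i]
  · intro j hj
    simp [(fixedBasis K).orthonormal.2 hj]

theorem trace_sum_mul {ι : Type*} {T : BOp K} (hT : IsTraceClass T) (A : ι → BOp K)
    (s : Finset ι) : trace ((∑ i ∈ s, A i) * T) = ∑ i ∈ s, trace (A i * T) := by
  unfold trace
  refine Eq.trans (tsum_congr fun j => ?_)
    (Summable.tsum_finsetSum fun i _ => hT.summable_inner_mul (A i))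
  rw [Finset.sum_mul, sum_apply, inner_sum]

theorem tendsto_wStarTopology_sum_rankOne_mul (X : BOp K) :
    Tendsto (fun s : Finset (basisIndex K) =>
      ∑ i ∈ s, (rankOne ℂ (fixedBasis K i) (fixedBasis K i) : BOp K) * X) atTop
      (@nhds _ (wStarTopology K) X) := by
  rw [nhds_induced, tendsto_comap_iff, tendsto_pi_nhds]
  rintro ⟨T, hT⟩
  refine (hasSum_trace_mul hT X).congr fun s => ?_
  exact (trace_sum_mul hT _ s).symm

theorem continuous_inner_wStarTopology (x y : K) :
    @Continuous _ _ (wStarTopology K) _ fun A : BOp K => inner ℂ x (A y) := by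
  let _ : TopologicalSpace (BOp K) := wStarTopology K
  have h := (continuous_apply
    (A := fun _ : {T : BOp K // IsTraceClass T} => ℂ) ⟨_, isTraceClass_rankOne y x⟩).comp
    (continuous_induced_dom (f := fun (A : BOp K) (T : {T : BOp K // IsTraceClass T}) =>
      trace (A * (T : BOp K))))
  refine h.congr fun A => ?_
  exact trace_mul_rankOne A y x

/-- This is the form in which weak-star continuity is used: `Ψ` is determined by its values on
rank-one operators, through a convergent series. -/
theorem hasSum_inner_map_rankOne_mul {L : Type*} [NormedAddCommGroup L] [InnerProductSpace ℂ L]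
    [CompleteSpace L] {Ψ : BOp K →ₗ[ℂ] BOp L}
    (hΨ : @Continuous _ _ (wStarTopology K) (wStarTopology L) Ψ) (X : BOp K) (x y : L) :
    HasSum (fun i => inner ℂ x (Ψ (rankOne ℂ (fixedBasis K i) (fixedBasis K i) * X) y))
      (inner ℂ x (Ψ X y)) := by
  let _ : TopologicalSpace (BOp K) := wStarTopology K
  let _ : TopologicalSpace (BOp L) := wStarTopology L
  have h := (((continuous_inner_wStarTopology x y).comp hΨ).tendsto X).comp
    (tendsto_wStarTopology_sum_rankOne_mul X)
  refine h.congr fun s => ?_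
  simp only [Function.comp_apply, map_sum, sum_apply, inner_sum]

end TraceClass

/-! ### Operators on the Hilbert space tensor square -/

section Tensor

variable {H : Type*} [NormedAddCommGroup H] [InnerProductSpace ℂ H]

theorem inner_htmul (x y z w : H) :
    inner ℂ (htmul x y) (htmul z w) = inner ℂ x z * inner ℂ y w := by
  simp [htmul]

theorem htmul_smul_left (c : ℂ) (x y : H) : htmul (c • x) y = c • htmul x y := by
  rw [htmul, ← TensorProduct.smul_tmul', UniformSpace.Completion.coe_smul, htmul]

theorem htmul_smul_right (c : ℂ) (x y : H) : htmul x (c • y) = c • htmul x y := by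
  simp [htmul, UniformSpace.Completion.coe_smul]

theorem htmul_add_left (x x' y : H) : htmul (x + x') y = htmul x y + htmul x' y := by
  simp [htmul, TensorProduct.add_tmul, UniformSpace.Completion.coe_add]

theorem htmul_add_right (x y y' : H) : htmul x (y + y') = htmul x y + htmul x y' := by
  simp [htmul, TensorProduct.tmul_add, UniformSpace.Completion.coe_add]

theorem ext_htmul {A B : BOp (HTensor H)} (h : ∀ x y, A (htmul x y) = B (htmul x y)) :
    A = B := by
  have h' : ∀ t : H ⊗[ℂ] H, A t = B t := fun t => by
    induction t with
    | zero => exact (map_zero A).trans (map_zero B).symm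
    | tmul x y => exact h x y
    | add s t hs ht => rw [UniformSpace.Completion.coe_add, map_add, map_add, hs, ht]
  ext t
  exact congrFun (UniformSpace.Completion.ext A.continuous B.continuous h') t

theorem ext_inner_htmul {s t : HTensor H} (h : ∀ x y, inner ℂ (htmul x y) s = inner ℂ (htmul x y) t) :
    s = t := by
  have h' : ∀ r : H ⊗[ℂ] H, inner ℂ (r : HTensor H) s = inner ℂ (r : HTensor H) t := fun r => by
    induction r with
    | zero => exact (inner_zero_left s).trans (inner_zero_left t).symm
    | tmul x y => exact h x y
    | add a b ha hb => rw [UniformSpace.Completion.coe_add, inner_add_left, inner_add_left, ha, hb]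
  refine ext_inner_left ℂ fun r => ?_
  exact congrFun (UniformSpace.Completion.ext (f := fun r : HTensor H => inner ℂ r s)
    (g := fun r : HTensor H => inner ℂ r t) (by fun_prop) (by fun_prop) h') r

theorem opTensor_mul_opTensor (A B C D : BOp H) :
    opTensor A B * opTensor C D = opTensor (A * C) (B * D) :=
  ext_htmul fun x y => by simp [opTensor_htmul]

theorem swapOp_mul_opTensor (A B : BOp H) :
    swapOp H * opTensor A B = opTensor B A * swapOp H :=
  ext_htmul fun x y => by simp [opTensor_htmul, swapOp_htmul]

/-- The derivation `A ⊗ 1 + 1 ⊗ A` on `H ⊗ H`. -/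
def leibniz (A : BOp H) : BOp (HTensor H) := opTensor A 1 + opTensor 1 A

theorem leibniz_add (A B : BOp H) : leibniz (A + B) = leibniz A + leibniz B :=
  ext_htmul fun x y => by
    simp only [leibniz, add_apply, opTensor_htmul, one_apply_eq_self, htmul_add_left,
      htmul_add_right]
    abel

theorem leibniz_smul (c : ℂ) (A : BOp H) : leibniz (c • A) = c • leibniz A :=
  ext_htmul fun x y => by
    simp only [leibniz, add_apply, smul_apply, opTensor_htmul, one_apply_eq_self, htmul_smul_left,
      htmul_smul_right, smul_add]

theorem opTensor_one_add_smul (c : ℂ) (A : BOp H) :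
    opTensor (1 + c • A) (1 + c • A) = 1 + c • leibniz A + c ^ 2 • opTensor A A :=
  ext_htmul fun x y => by
    simp only [leibniz, add_apply, smul_apply, opTensor_htmul, one_apply_eq_self, htmul_smul_left,
      htmul_smul_right, htmul_add_left, htmul_add_right]
    module

variable [CompleteSpace H]

theorem inner_htmul_opTensor (A B : BOp H) (x y : H) (t : HTensor H) :
    inner ℂ (htmul x y) (opTensor A B t) = inner ℂ (htmul (star A x) (star B y)) t := by
  have h : opTensor A B = star (opTensor (star A) (star B)) := by
    refine ext_htmul fun z w => ext_inner_htmul fun x y => ?_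
    rw [ContinuousLinearMap.star_eq_adjoint (opTensor _ _), ContinuousLinearMap.adjoint_inner_right,
      opTensor_htmul, opTensor_htmul, inner_htmul, inner_htmul, ContinuousLinearMap.star_eq_adjoint,
      ContinuousLinearMap.star_eq_adjoint, ContinuousLinearMap.adjoint_inner_left,
      ContinuousLinearMap.adjoint_inner_left]
  rw [h, ContinuousLinearMap.star_eq_adjoint (opTensor _ _),
    ContinuousLinearMap.adjoint_inner_right, opTensor_htmul]

end Tensor

/-- A finite substitute for differentiating at `z = 1`. Subtracting the relations at `z` and its
conjugate removes `p` and `u`; weighting two such differences, at `I` and at the rational point `3/5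
+ 4/5 I`, cancels `q, r, s, t` and leaves `a - b`. -/
theorem eq_of_forall_unit_norm {M : Type*} [AddCommGroup M] [Module ℂ M]
    {a b p q r s t u : M} (h : ∀ z : ℂ, z * starRingEnd ℂ z = 1 →
      (z - 1) • a + (starRingEnd ℂ z - 1) • b + ((z - 1) * (starRingEnd ℂ z - 1)) • p +
      (z - 1) ^ 2 • q + (starRingEnd ℂ z - 1) ^ 2 • r +
      ((z - 1) ^ 2 * (starRingEnd ℂ z - 1)) • s +
      ((z - 1) * (starRingEnd ℂ z - 1) ^ 2) • t +
      ((z - 1) ^ 2 * (starRingEnd ℂ z - 1) ^ 2) • u = 0) : a = b := by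
  have h1 := h Complex.I (by simp)
  have h2 := h (-Complex.I) (by simp)
  have hI : Complex.I ^ 2 = -1 := Complex.I_sq
  have h3 := h (3 / 5 + 4 / 5 * Complex.I) (by
    simp only [map_add, map_mul, map_div₀, map_ofNat, Complex.conj_I]
    linear_combination (-16/25 : ℂ) * hI)
  have h4 := h (3 / 5 - 4 / 5 * Complex.I) (by
    simp only [map_sub, map_mul, map_div₀, map_ofNat, Complex.conj_I]
    linear_combination (-16/25 : ℂ) * hI)
  simp only [map_add, map_sub, map_neg, map_mul, map_div₀, map_ofNat, Complex.conj_I] at h1 h2 h3 h4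
  have hI4 : Complex.I ^ 4 = 1 := Complex.I_pow_four
  linear_combination (norm := skip) (Complex.I / 3) • h1 - (Complex.I / 3) • h2 -
    (25 * Complex.I / 24) • h3 + (25 * Complex.I / 24) • h4
  match_scalars <;> ring_nf <;> simp only [hI, hI4] <;> ring

/-! ### From covariance to the Leibniz rule -/

section RankOne

theorem rankOne_mem_span_rankOne_self {H : Type*} [NormedAddCommGroup H] [InnerProductSpace ℂ H]
    (x y : H) : (rankOne ℂ x y : BOp H) ∈
      Submodule.span ℂ {P : BOp H | ∃ e : H, ‖e‖ = 1 ∧ P = rankOne ℂ e e} := by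
  set S := Submodule.span ℂ {P : BOp H | ∃ e : H, ‖e‖ = 1 ∧ P = rankOne ℂ e e}
  have hself (v : H) : (rankOne ℂ v v : BOp H) ∈ S := by
    rcases eq_or_ne v 0 with rfl | hv
    · simp
    have hv' : (‖v‖ : ℂ) ≠ 0 := by simpa using hv
    have h : (rankOne ℂ v v : BOp H) = ((‖v‖ : ℂ) ^ 2) •
        (rankOne ℂ ((‖v‖ : ℂ)⁻¹ • v) ((‖v‖ : ℂ)⁻¹ • v) : BOp H) := by
      ext z
      simp only [rankOne_apply, smul_apply, inner_smul_left, smul_smul, map_inv₀,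
        Complex.conj_ofReal]
      congr 1
      field_simp
    rw [h]
    exact S.smul_mem _ (Submodule.subset_span ⟨_, by simp [norm_smul, hv], rfl⟩)
  -- Polarization, as `rankOne` is linear in `x` and antilinear in `y`.
  have h : (rankOne ℂ x y : BOp H) = (4⁻¹ : ℂ) • ((rankOne ℂ (x + y) (x + y) : BOp H) -
      rankOne ℂ (x - y) (x - y) +
      Complex.I • (rankOne ℂ (x + Complex.I • y) (x + Complex.I • y) -
        rankOne ℂ (x - Complex.I • y) (x - Complex.I • y) : BOp H)) := by
    ext z
    simp only [rankOne_apply, smul_apply, add_apply, sub_apply, inner_add_left, inner_sub_left,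
      inner_smul_left, Complex.conj_I]
    match_scalars <;> ring_nf <;> simp
    ring
  rw [h]
  exact S.smul_mem _ (S.add_mem (S.sub_mem (hself _) (hself _))
    (S.smul_mem _ (S.sub_mem (hself _) (hself _))))

variable {H : Type*} [NormedAddCommGroup H] [InnerProductSpace ℂ H] [CompleteSpace H]

/-- Covariance on the rank-one projections extends to all operators of rank one. -/
theorem covariant_rankOne {Ψ : BOp H →ₗ[ℂ] BOp (HTensor H)}
    (h : ∀ e : H, ‖e‖ = 1 → ∀ U ∈ unitary (BOp H),
        Ψ (U * rankOne ℂ e e * star U) =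
          opTensor U U * Ψ (rankOne ℂ e e) * opTensor (star U) (star U))
    (x y : H) {U : BOp H} (hU : U ∈ unitary (BOp H)) :
    Ψ (U * rankOne ℂ x y * star U) =
      opTensor U U * Ψ (rankOne ℂ x y) * opTensor (star U) (star U) := by
  have hmem := rankOne_mem_span_rankOne_self x y
  generalize (rankOne ℂ x y : BOp H) = R at hmem ⊢
  induction hmem using Submodule.span_induction with
  | mem P hP =>
    obtain ⟨e, he, rfl⟩ := hP
    exact h e he U hU
  | zero => simp
  | add A B _ _ hA hB => simp only [mul_add, add_mul, map_add, hA, hB]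
  | smul c A _ hA => simp only [mul_smul_comm, smul_mul_assoc, map_smul, hA]

theorem one_add_smul_rankOne_mem_unitary {e : H} (he : ‖e‖ = 1) {z : ℂ}
    (hz : z * starRingEnd ℂ z = 1) :
    (1 + (z - 1) • rankOne ℂ e e : BOp H) ∈ unitary (BOp H) ∧
      star (1 + (z - 1) • rankOne ℂ e e : BOp H) =
        1 + (starRingEnd ℂ z - 1) • rankOne ℂ e e := by
  have hs : star (1 + (z - 1) • rankOne ℂ e e : BOp H) =
        1 + (starRingEnd ℂ z - 1) • rankOne ℂ e e := by
    simp [ContinuousLinearMap.star_eq_adjoint (rankOne ℂ e e : BOp H)]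
  have hP : (rankOne ℂ e e * rankOne ℂ e e : BOp H) = rankOne ℂ e e :=
    isIdempotentElem_rankOne_self he
  refine ⟨Unitary.mem_iff.2 ⟨?_, ?_⟩, hs⟩
  all_goals
    rw [hs]
    simp only [mul_add, add_mul, mul_one, one_mul, mul_smul_comm, smul_mul_assoc, hP]
    match_scalars
    · ring
    · linear_combination hz

/-- The infinitesimal form of covariance. -/
theorem map_lie_of_covariant {Ψ : BOp H →ₗ[ℂ] BOp (HTensor H)} {X : BOp H}
    (h : ∀ U ∈ unitary (BOp H),
      Ψ (U * X * star U) = opTensor U U * Ψ X * opTensor (star U) (star U)) (x y : H) :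
    Ψ (rankOne ℂ x y * X - X * rankOne ℂ x y) =
      leibniz (rankOne ℂ x y) * Ψ X - Ψ X * leibniz (rankOne ℂ x y) := by
  have hmem := rankOne_mem_span_rankOne_self x y
  generalize (rankOne ℂ x y : BOp H) = R at hmem ⊢
  induction hmem using Submodule.span_induction with
  | mem P hP =>
    obtain ⟨e, he, rfl⟩ := hP
    set W : BOp H := rankOne ℂ e e
    suffices hs : Ψ (W * X) - leibniz W * Ψ X = Ψ (X * W) - Ψ X * leibniz W by
      rw [map_sub]
      exact sub_eq_sub_iff_sub_eq_sub.1 hs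
    -- The remaining coefficients come from expanding covariance under `1 + (z - 1) W` in powers of
    -- `z - 1` and its conjugate.
    refine eq_of_forall_unit_norm
      (p := Ψ (W * X * W) - leibniz W * Ψ X * leibniz W)
      (q := -(opTensor W W * Ψ X)) (r := -(Ψ X * opTensor W W))
      (s := -(opTensor W W * Ψ X * leibniz W)) (t := -(leibniz W * Ψ X * opTensor W W))
      (u := -(opTensor W W * Ψ X * opTensor W W)) fun z hz => ?_
    obtain ⟨hU, hs⟩ := one_add_smul_rankOne_mem_unitary he hz
    have hc := h _ hU
    rw [hs, opTensor_one_add_smul, opTensor_one_add_smul] at hc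
    simp only [mul_add, add_mul, mul_one, one_mul, mul_smul_comm, smul_mul_assoc, map_add,
      map_smul] at hc
    rw [← sub_eq_zero] at hc
    rw [← hc]
    module
  | zero =>
    have h0 : leibniz (0 : BOp H) = 0 := by simpa using leibniz_smul 0 (0 : BOp H)
    simp [h0]
  | add A B _ _ hA hB =>
    simp only [mul_add, add_mul, map_add, map_sub, leibniz_add] at hA hB ⊢
    rw [add_sub_add_comm, hA, hB]
    abel
  | smul c A _ hA =>
    simp only [mul_smul_comm, smul_mul_assoc, map_smul, ← smul_sub, leibniz_smul, hA]

end RankOne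

/-! ### Invariant theory of the matrix coefficients -/

section Coefficients

variable {H : Type*} [NormedAddCommGroup H] [InnerProductSpace ℂ H]

/-- The matrix coefficients of a linear map `B(H) → B(H ⊗ H)` on operators of rank one. -/
def coeff (Ψ : BOp H →ₗ[ℂ] BOp (HTensor H)) (x₁ x₂ x₃ y₁ y₂ y₃ : H) : ℂ :=
  inner ℂ (htmul y₂ y₃) (Ψ (rankOne ℂ x₁ y₁) (htmul x₂ x₃))

theorem coeff_derivation [CompleteSpace H] {Ψ : BOp H →ₗ[ℂ] BOp (HTensor H)}
    (h : ∀ x y : H, ∀ U ∈ unitary (BOp H),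
      Ψ (U * rankOne ℂ x y * star U) =
        opTensor U U * Ψ (rankOne ℂ x y) * opTensor (star U) (star U))
    (u v x₁ x₂ x₃ y₁ y₂ y₃ : H) :
    inner ℂ u x₁ * coeff Ψ v x₂ x₃ y₁ y₂ y₃ + inner ℂ u x₂ * coeff Ψ x₁ v x₃ y₁ y₂ y₃ +
        inner ℂ u x₃ * coeff Ψ x₁ x₂ v y₁ y₂ y₃ =
      inner ℂ y₁ v * coeff Ψ x₁ x₂ x₃ u y₂ y₃ + inner ℂ y₂ v * coeff Ψ x₁ x₂ x₃ y₁ u y₃ +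
        inner ℂ y₃ v * coeff Ψ x₁ x₂ x₃ y₁ y₂ u := by
  have key := congrArg (fun A : BOp (HTensor H) => inner ℂ (htmul y₂ y₃) (A (htmul x₂ x₃)))
    (map_lie_of_covariant (h x₁ y₁) v u)
  have h1 : (rankOne ℂ v u * rankOne ℂ x₁ y₁ : BOp H) = inner ℂ u x₁ • rankOne ℂ v y₁ :=
    rankOne_comp_rankOne v u x₁ y₁
  have h2 : (rankOne ℂ x₁ y₁ * rankOne ℂ v u : BOp H) = inner ℂ y₁ v • rankOne ℂ x₁ u :=
    rankOne_comp_rankOne x₁ y₁ v u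
  rw [h1, h2] at key
  simp only [leibniz, map_sub, map_smul, sub_apply, smul_apply, mul_apply_eq_comp, add_apply,
    inner_sub_right, inner_smul_right, inner_add_right, map_add, inner_htmul_opTensor,
    opTensor_htmul, rankOne_apply, star_one, one_apply_eq_self, htmul_smul_left, htmul_smul_right,
    ContinuousLinearMap.star_eq_adjoint (rankOne ℂ v u : BOp H), adjoint_rankOne,
    inner_smul_left, inner_conj_symm] at key
  unfold coeff
  linear_combination key

theorem exists_unit_orthogonal (hdim : ¬ FiniteDimensional ℂ H) (s : Finset H) :
    ∃ u : H, ‖u‖ = 1 ∧ ∀ x ∈ s, inner ℂ u x = 0 := by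
  let S := Submodule.span ℂ (s : Set H)
  have hfin : FiniteDimensional ℂ S := FiniteDimensional.span_finset ℂ s
  have hne : Sᗮ ≠ ⊥ := fun h => hdim <| by
    rw [Submodule.orthogonal_eq_bot_iff] at h
    rw [h] at hfin
    exact LinearEquiv.finiteDimensional (Submodule.topEquiv (R := ℂ) (M := H))
  obtain ⟨v, hv, hv0⟩ := Submodule.exists_mem_ne_zero_of_ne_bot hne
  refine ⟨(‖v‖⁻¹ : ℂ) • v, by simp [norm_smul, hv0], fun x hx => ?_⟩
  rw [inner_smul_left, (Submodule.mem_orthogonal' S v).1 hv x (Submodule.subset_span hx), mul_zero]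

/-- Contracting with `u₃` trades `x₃` for `u₃`, the other contractions on the left vanishing by
orthogonality, and pairs `x₃` with each `yⱼ` in turn. Repeating with `u₂`, then `u₁`, uses up all
the `xᵢ`. -/
theorem coeff_eq_of_orthogonal [CompleteSpace H] {Ψ : BOp H →ₗ[ℂ] BOp (HTensor H)}
    (h : ∀ x y : H, ∀ U ∈ unitary (BOp H),
      Ψ (U * rankOne ℂ x y * star U) =
        opTensor U U * Ψ (rankOne ℂ x y) * opTensor (star U) (star U))
    {u₁ u₂ u₃ x₁ x₂ : H} (hu₁ : ‖u₁‖ = 1) (hu₂ : ‖u₂‖ = 1) (hu₃ : ‖u₃‖ = 1)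
    (h12 : inner ℂ u₁ u₂ = 0) (h13 : inner ℂ u₁ u₃ = 0) (h23 : inner ℂ u₂ u₃ = 0)
    (hx21 : inner ℂ u₂ x₁ = 0) (hx31 : inner ℂ u₃ x₁ = 0) (hx32 : inner ℂ u₃ x₂ = 0)
    (x₃ y₁ y₂ y₃ : H) :
    coeff Ψ x₁ x₂ x₃ y₁ y₂ y₃ =
      inner ℂ y₁ x₁ * inner ℂ y₂ x₂ * inner ℂ y₃ x₃ * coeff Ψ u₁ u₂ u₃ u₁ u₂ u₃ +
      inner ℂ y₁ x₁ * inner ℂ y₂ x₃ * inner ℂ y₃ x₂ * coeff Ψ u₁ u₂ u₃ u₁ u₃ u₂ +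
      inner ℂ y₁ x₂ * inner ℂ y₂ x₁ * inner ℂ y₃ x₃ * coeff Ψ u₁ u₂ u₃ u₂ u₁ u₃ +
      inner ℂ y₁ x₂ * inner ℂ y₂ x₃ * inner ℂ y₃ x₁ * coeff Ψ u₁ u₂ u₃ u₂ u₃ u₁ +
      inner ℂ y₁ x₃ * inner ℂ y₂ x₁ * inner ℂ y₃ x₂ * coeff Ψ u₁ u₂ u₃ u₃ u₁ u₂ +
      inner ℂ y₁ x₃ * inner ℂ y₂ x₂ * inner ℂ y₃ x₁ * coeff Ψ u₁ u₂ u₃ u₃ u₂ u₁ := by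
  have hself {u : H} (hu : ‖u‖ = 1) : inner ℂ u u = (1 : ℂ) := by
    simp [inner_self_eq_norm_sq_to_K, hu]
  have e₃ := coeff_derivation h u₃ x₃ x₁ x₂ u₃ y₁ y₂ y₃
  have e₂ (y₁ y₂ y₃ : H) := coeff_derivation h u₂ x₂ x₁ u₂ u₃ y₁ y₂ y₃
  have e₁ (y₁ y₂ y₃ : H) := coeff_derivation h u₁ x₁ u₁ u₂ u₃ y₁ y₂ y₃
  simp only [hx31, hx32, hx21, hself hu₃, hself hu₂, hself hu₁, h12, h13, h23, zero_mul, zero_add,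
    add_zero, one_mul] at e₁ e₂ e₃
  simp only [e₃, e₂ u₃ y₂ y₃, e₂ y₁ u₃ y₃, e₂ y₁ y₂ u₃, e₁ u₂ u₃ y₃, e₁ u₂ y₂ u₃, e₁ u₃ u₂ y₃,
    e₁ y₁ u₂ u₃, e₁ u₃ y₂ u₂, e₁ y₁ u₃ u₂, hx31, hx32, hx21, zero_mul, zero_add,
    add_zero]
  ring

/-- Invariant theory of the unitary group: the coefficients of a covariant map are combinations of
the six complete pairings. -/
theorem exists_coeff_eq [CompleteSpace H] (hdim : ¬ FiniteDimensional ℂ H)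
    {Ψ : BOp H →ₗ[ℂ] BOp (HTensor H)}
    (h : ∀ x y : H, ∀ U ∈ unitary (BOp H),
      Ψ (U * rankOne ℂ x y * star U) =
        opTensor U U * Ψ (rankOne ℂ x y) * opTensor (star U) (star U)) :
    ∃ c₁ c₂ c₃ c₄ c₅ c₆ : ℂ, ∀ x₁ x₂ x₃ y₁ y₂ y₃ : H, coeff Ψ x₁ x₂ x₃ y₁ y₂ y₃ =
      inner ℂ y₁ x₁ * inner ℂ y₂ x₂ * inner ℂ y₃ x₃ * c₁ +
      inner ℂ y₁ x₁ * inner ℂ y₂ x₃ * inner ℂ y₃ x₂ * c₂ +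
      inner ℂ y₁ x₂ * inner ℂ y₂ x₁ * inner ℂ y₃ x₃ * c₃ +
      inner ℂ y₁ x₂ * inner ℂ y₂ x₃ * inner ℂ y₃ x₁ * c₄ +
      inner ℂ y₁ x₃ * inner ℂ y₂ x₁ * inner ℂ y₃ x₂ * c₅ +
      inner ℂ y₁ x₃ * inner ℂ y₂ x₂ * inner ℂ y₃ x₁ * c₆ := by
  classical
  have hself {u : H} (hu : ‖u‖ = 1) : inner ℂ u u = (1 : ℂ) := by
    simp [inner_self_eq_norm_sq_to_K, hu]
  obtain ⟨w₃, hw₃, -⟩ := exists_unit_orthogonal hdim ∅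
  obtain ⟨w₂, hw₂, hw₂'⟩ := exists_unit_orthogonal hdim {w₃}
  obtain ⟨w₁, hw₁, hw₁'⟩ := exists_unit_orthogonal hdim {w₂, w₃}
  simp only [Finset.mem_insert, Finset.mem_singleton, forall_eq_or_imp, forall_eq] at hw₂' hw₁'
  obtain ⟨h12, h13⟩ := hw₁'
  have h21 := inner_eq_zero_symm.1 h12
  have h31 := inner_eq_zero_symm.1 h13
  have h32 := inner_eq_zero_symm.1 hw₂'
  refine ⟨coeff Ψ w₁ w₂ w₃ w₁ w₂ w₃, coeff Ψ w₁ w₂ w₃ w₁ w₃ w₂, coeff Ψ w₁ w₂ w₃ w₂ w₁ w₃,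
    coeff Ψ w₁ w₂ w₃ w₂ w₃ w₁, coeff Ψ w₁ w₂ w₃ w₃ w₁ w₂, coeff Ψ w₁ w₂ w₃ w₃ w₂ w₁,
    fun x₁ x₂ x₃ y₁ y₂ y₃ => ?_⟩
  -- The `uᵢ` serve both the given `xᵢ` and the fixed frame `wᵢ`; evaluating on the frame shows that
  -- the six constants do not depend on the `uᵢ`.
  obtain ⟨u₃, hu₃, hu₃'⟩ := exists_unit_orthogonal hdim {x₁, x₂, w₁, w₂}
  obtain ⟨u₂, hu₂, hu₂'⟩ := exists_unit_orthogonal hdim {u₃, x₁, w₁}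
  obtain ⟨u₁, hu₁, hu₁'⟩ := exists_unit_orthogonal hdim {u₂, u₃}
  simp only [Finset.mem_insert, Finset.mem_singleton, forall_eq_or_imp, forall_eq] at hu₃' hu₂' hu₁'
  have hw := coeff_eq_of_orthogonal h hu₁ hu₂ hu₃ hu₁'.1 hu₁'.2 hu₂'.1 hu₂'.2.2 hu₃'.2.2.1
    hu₃'.2.2.2 w₃
  rw [coeff_eq_of_orthogonal h hu₁ hu₂ hu₃ hu₁'.1 hu₁'.2 hu₂'.1 hu₂'.2.1 hu₃'.1 hu₃'.2.1]
  simp only [hw, hself hw₁, hself hw₂, hself hw₃, h12, h13, hw₂', h21, h31, h32, mul_zero, zero_mul,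
    mul_one, one_mul, add_zero, zero_add]

variable [CompleteSpace H]

theorem infinite_basisIndex (hdim : ¬ FiniteDimensional ℂ H) : Infinite (basisIndex H) := by
  by_contra hfin
  rw [not_infinite_iff_finite] at hfin
  have := Fintype.ofFinite (basisIndex H)
  exact hdim ((fixedBasis H).toOrthonormalBasis.toBasis.finiteDimensional_of_finite)

theorem tendsto_inner_fixedBasis (x : H) :
    Tendsto (fun i => inner ℂ (fixedBasis H i) x) cofinite (𝓝 0) := by
  have h := (hasSum_norm_inner_sq (fixedBasis H) x).summable.tendsto_cofinite_zero
  rw [tendsto_zero_iff_norm_tendsto_zero]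
  simpa [Function.comp_def] using (Real.continuous_sqrt.tendsto 0).comp h

theorem exists_eq_of_covariant (hdim : ¬ FiniteDimensional ℂ H)
    {Ψ : BOp H →ₗ[ℂ] BOp (HTensor H)}
    (hΨ : @Continuous _ _ (wStarTopology H) (wStarTopology (HTensor H)) Ψ)
    (h : ∀ x y : H, ∀ U ∈ unitary (BOp H),
      Ψ (U * rankOne ℂ x y * star U) =
        opTensor U U * Ψ (rankOne ℂ x y) * opTensor (star U) (star U)) :
    ∃ l₁ l₂ l₃ l₄ : ℂ, ∀ X : BOp H,
      Ψ X = l₁ • opTensor 1 X + l₂ • opTensor X 1 + l₃ • (swapOp H * opTensor 1 X) +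
        l₄ • (swapOp H * opTensor X 1) := by
  obtain ⟨c₁, c₂, c₃, c₄, c₅, c₆, hc⟩ := exists_coeff_eq hdim h
  -- The coefficients of `Ψ(eᵢeᵢ*)` are summable, hence tend to zero, while all but the two trace
  -- pairings vanish in the limit because `⟪eᵢ, x⟫ → 0`.
  have hzero (x₂ x₃ y₂ y₃ : H) :
      inner ℂ y₂ x₂ * inner ℂ y₃ x₃ * c₁ + inner ℂ y₂ x₃ * inner ℂ y₃ x₂ * c₂ = 0 := by
    have := infinite_basisIndex hdim
    have h0 := (hasSum_inner_map_rankOne_mul hΨ 1 (htmul y₂ y₃)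
      (htmul x₂ x₃)).summable.tendsto_cofinite_zero
    have hb (x : H) := tendsto_inner_fixedBasis x
    have hb' (y : H) : Tendsto (fun i => inner ℂ y (fixedBasis H i)) cofinite (𝓝 0) := by
      simpa [Function.comp_def] using (Complex.continuous_conj.tendsto 0).comp (hb y)
    have h1 := ((((tendsto_const_nhds (x := inner ℂ y₂ x₂ * inner ℂ y₃ x₃ * c₁ +
        inner ℂ y₂ x₃ * inner ℂ y₃ x₂ * c₂)).add
      (((hb x₂).mul (hb' y₂)).mul_const (inner ℂ y₃ x₃ * c₃))).add
      (((hb x₂).mul (hb' y₃)).mul_const (inner ℂ y₂ x₃ * c₄))).add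
      (((hb x₃).mul (hb' y₂)).mul_const (inner ℂ y₃ x₂ * c₅))).add
      (((hb x₃).mul (hb' y₃)).mul_const (inner ℂ y₂ x₂ * c₆))
    simp only [zero_mul, add_zero] at h1
    refine tendsto_nhds_unique (h1.congr fun i => ?_) h0
    have hi : inner ℂ (fixedBasis H i) (fixedBasis H i) = (1 : ℂ) := by
      simp [inner_self_eq_norm_sq_to_K, (fixedBasis H).orthonormal.1 i]
    have hci := hc (fixedBasis H i) x₂ x₃ (fixedBasis H i) y₂ y₃
    rw [coeff, hi] at hci
    rw [mul_one, hci]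
    ring
  -- The surviving pairings are matched with `I ⊗ X`, `X ⊗ I`, `S(I ⊗ X)`, `S(X ⊗ I)` in this order.
  refine ⟨c₆, c₃, c₅, c₄, fun X => ext_htmul fun x₂ x₃ => ext_inner_htmul fun y₂ y₃ => ?_⟩
  refine (hasSum_inner_map_rankOne_mul hΨ X (htmul y₂ y₃) (htmul x₂ x₃)).unique ?_
  have hs (y x : H) := (fixedBasis H).hasSum_inner_mul_inner y (X x)
  have h1 := ((((hs y₃ x₃).mul_left (c₆ * inner ℂ y₂ x₂)).add
      ((hs y₂ x₂).mul_left (c₃ * inner ℂ y₃ x₃))).add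
      ((hs y₂ x₃).mul_left (c₅ * inner ℂ y₃ x₂))).add
      ((hs y₃ x₂).mul_left (c₄ * inner ℂ y₂ x₃))
  have hval : inner ℂ (htmul y₂ y₃) ((c₆ • opTensor 1 X + c₃ • opTensor X 1 +
      c₅ • (swapOp H * opTensor 1 X) + c₄ • (swapOp H * opTensor X 1)) (htmul x₂ x₃)) =
      c₆ * inner ℂ y₂ x₂ * inner ℂ y₃ (X x₃) + c₃ * inner ℂ y₃ x₃ * inner ℂ y₂ (X x₂) +
      c₅ * inner ℂ y₃ x₂ * inner ℂ y₂ (X x₃) + c₄ * inner ℂ y₂ x₃ * inner ℂ y₃ (X x₂) := by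
    simp only [add_apply, smul_apply, mul_apply_eq_comp, opTensor_htmul, swapOp_htmul,
      one_apply_eq_self, inner_add_right, inner_smul_right, inner_htmul]
    ring
  rw [hval]
  refine h1.congr_fun fun i => ?_
  have hX : (rankOne ℂ (fixedBasis H i) (fixedBasis H i) * X : BOp H) =
      rankOne ℂ (fixedBasis H i) (star X (fixedBasis H i)) := by
    rw [ContinuousLinearMap.star_eq_adjoint]
    exact rankOne_comp _ _ X
  have hci := hc (fixedBasis H i) x₂ x₃ (star X (fixedBasis H i)) y₂ y₃
  rw [coeff, ContinuousLinearMap.star_eq_adjoint, ContinuousLinearMap.adjoint_inner_left,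
    ContinuousLinearMap.adjoint_inner_left, ContinuousLinearMap.adjoint_inner_left] at hci
  rw [hX, ContinuousLinearMap.star_eq_adjoint, hci]
  linear_combination inner ℂ (fixedBasis H i) (X (fixedBasis H i)) *
    hzero x₂ x₃ y₂ y₃

theorem isUnitarilyCovariant_of_eq {Ψ : BOp H →ₗ[ℂ] BOp (HTensor H)} {l₁ l₂ l₃ l₄ : ℂ}
    (h : ∀ X : BOp H,
      Ψ X = l₁ • opTensor 1 X + l₂ • opTensor X 1 + l₃ • (swapOp H * opTensor 1 X) +
        l₄ • (swapOp H * opTensor X 1)) : IsUnitarilyCovariant Ψ := by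
  intro X U hU
  have hUU : U * star U = 1 := (Unitary.mem_iff.1 hU).2
  have hswap (A : BOp (HTensor H)) :
      opTensor U U * (swapOp H * A) * opTensor (star U) (star U) =
        swapOp H * (opTensor U U * A * opTensor (star U) (star U)) := by
    rw [← mul_assoc, ← swapOp_mul_opTensor, mul_assoc, mul_assoc, mul_assoc]
  rw [h, h]
  simp only [mul_add, add_mul, mul_smul_comm, smul_mul_assoc, hswap, opTensor_mul_opTensor, mul_one,
    hUU]

end Coefficients

end

end CovariantMaps

theorem theorem3 {H : Type*} [NormedAddCommGroup H] [InnerProductSpace ℂ H] [CompleteSpace H]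
    [TopologicalSpace.SeparableSpace H] (hdim : ¬ FiniteDimensional ℂ H)
    (Ψ : CovariantMaps.BOp H →ₗ[ℂ] CovariantMaps.BOp (CovariantMaps.HTensor H))
    (hΨ : @Continuous _ _ (CovariantMaps.wStarTopology H)
      (CovariantMaps.wStarTopology (CovariantMaps.HTensor H)) Ψ) :
    List.TFAE [
      CovariantMaps.IsUnitarilyCovariant Ψ,
      ∀ e : H, ‖e‖ = 1 → ∀ U ∈ unitary (CovariantMaps.BOp H),
        Ψ (U * InnerProductSpace.rankOne ℂ e e * star U) =
          CovariantMaps.opTensor U U * Ψ (InnerProductSpace.rankOne ℂ e e) *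
            CovariantMaps.opTensor (star U) (star U),
      ∃ l₁ l₂ l₃ l₄ : ℂ, ∀ X : CovariantMaps.BOp H,
        Ψ X = l₁ • CovariantMaps.opTensor 1 X + l₂ • CovariantMaps.opTensor X 1 +
          l₃ • (CovariantMaps.swapOp H * CovariantMaps.opTensor 1 X) +
          l₄ • (CovariantMaps.swapOp H * CovariantMaps.opTensor X 1)] := by
  tfae_have 1 → 2 := fun h e _ U hU => h _ U hU
  tfae_have 2 → 3 := fun h => CovariantMaps.exists_eq_of_covariant hdim hΨ
    fun x y _ hU => CovariantMaps.covariant_rankOne h x y hU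
  tfae_have 3 → 1 := fun ⟨_, _, _, _, h⟩ => CovariantMaps.isUnitarilyCovariant_of_eq h
  tfae_finish
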